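/- A finite simple graph $G$ is *representable* in $\mathbb{R}^m$ if there are a map $f$ from its vertex set to $\mathbb{R}^m$ and distinct positive constants $\alpha,\beta$ such that, for all distinct vertices $u,v$, the Euclidean distance $\|f(u)-f(v)\|$ equals $\alpha$ if $u$ and $v$ are adjacent and $\beta$ otherwise. The *Euclidean representation number* $\mathrm{Rep}(G)$ is the smallest $m$ such that $G$ is representable in $\mathbb{R}^m$. A graph is *strongly regular* with parameters $(n,k,\lambda,\mu)$ if it has $n$ vertices, every vertex has degree $k$, any two adjacent vertices have exactly $\lambda$ common neighbours, and any two distinct non-adjacent vertices have exactly $\mu$ common neighbours. A graph is *complete multipartite* if non-adjacency (or equality) is an equivalence relation on its vertices; this includes complete graphs and edgeless graphs. **Corollary.** Let $G$ be a strongly regular graph with parameters $(n,k,\lambda,\mu)$ such that neither $G$ nor its complement is complete multipartite. Then $G$ is representable in some $\mathbb{R}^m$ (so that $\mathrm{Rep}(G)$ is defined), $(\mu-\lambda)^2+4(k-\mu)>0$, and \[ \mathrm{Rep}(G)=\frac12\left(n-1-\frac{|(n-1)(\mu-\lambda)-2k|}{\sqrt{(\mu-\lambda)^2+4(k-\mu)}}\right).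 \] -/

import Mathlib

/-- `G.IsRepresentable m`: the vertices of `G` can be placed in the Euclidean space `ℝ^m` such that
any two distinct vertices are at Euclidean distance `α` if they are adjacent and at distance `β`
otherwise, for some distinct positive constants `α` and `β`. (As `α` and `β` are positive, such a
placement is automatically injective.) -/
def SimpleGraph.IsRepresentable {V : Type*} (G : SimpleGraph V) (m : ℕ) : Prop :=
  ∃ (f : V → EuclideanSpace ℝ (Fin m)) (α β : ℝ), 0 < α ∧ 0 < β ∧ α ≠ β ∧
    ∀ u v : V, u ≠ v → (G.Adj u v → ‖f u - f v‖ = α) ∧ (¬ G.Adj u v → ‖f u - f v‖ = β)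

/-- The Euclidean representation number of `G`: the smallest `m` such that `G` is representable
in `ℝ^m`. -/
noncomputable def SimpleGraph.rep {V : Type*} (G : SimpleGraph V) : ℕ :=
  sInf {m : ℕ | G.IsRepresentable m}

/-! On sum-zero vectors the adjacency matrix `A` has two eigenvalues `b < -1` and `0 < a`. Each
eigenprojection is a combination of `A`, `1` and the all-ones matrix `J`, so as a Gram matrix it
gives a two-distance set, in dimension its rank (`isRepresentable_rank_eigenProj`). Conversely, the
squared-distance matrix of a representation acts on the eigenspace of `a` as `(α² - β²)a - β²`, and
likewise for `b`; where this scalar is nonzero, the eigenspace has dimension at most `m`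
(`rank_eigenProj_le`). As `α ≠ β`, the two scalars cannot both vanish, so `G.rep` is the smaller
multiplicity. -/

open Matrix in
/-- The rank of an idempotent matrix is its trace. -/
theorem Matrix.rank_eq_trace_of_isIdempotentElem {V K : Type*} [Fintype V] [DecidableEq V] [Field K]
    {E : Matrix V V K} (hE : IsIdempotentElem E) : (E.rank : K) = E.trace := by
  have h : IsIdempotentElem (Matrix.toLin' E) := by
    unfold IsIdempotentElem
    rw [Module.End.mul_eq_comp, ← Matrix.toLin'_mul, hE.eq]
  have h2 := (LinearMap.IsIdempotentElem.isProj_range _ h).trace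
  rw [Matrix.trace_toLin'_eq] at h2
  rw [h2, Matrix.rank, Matrix.toLin'_apply']

/-- A symmetric idempotent matrix is a Gram matrix of vectors in a space of dimension its rank. -/
theorem Matrix.exists_inner_eq_of_isIdempotentElem {V : Type*} [Fintype V] [DecidableEq V]
    {E : Matrix V V ℝ} (hE : IsIdempotentElem E) (hsymm : E.IsSymm) :
    ∃ f : V → EuclideanSpace ℝ (Fin E.rank), ∀ u v, inner ℝ (f u) (f v) = E u v := by
  let W : Submodule ℝ (EuclideanSpace ℝ V) := LinearMap.range (Matrix.toEuclideanLin E)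
  have hW : Module.finrank ℝ W = E.rank :=
    (E.rank_eq_finrank_range_toLin (PiLp.basisFun 2 ℝ V) (PiLp.basisFun 2 ℝ V)).symm
  let φ : W ≃ₗᵢ[ℝ] EuclideanSpace ℝ (Fin E.rank) :=
    ((stdOrthonormalBasis ℝ W).reindex (finCongr hW)).repr
  refine ⟨fun v => φ ⟨Matrix.toEuclideanLin E (EuclideanSpace.single v 1), _, rfl⟩, fun u v => ?_⟩
  rw [φ.inner_map_map, Submodule.coe_inner, PiLp.inner_apply]
  conv_rhs => rw [← hE.eq, Matrix.mul_apply]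
  refine Finset.sum_congr rfl fun w _ => ?_
  simp [Matrix.toLpLin_apply, hsymm.apply w u, mul_comm]

open Matrix in
/-- If a matrix `E` with `J E = 0` satisfies `D E = c E`, `c ≠ 0`, where `D` is the
matrix of squared distances of points in `ℝ^m`, then `E` has rank at most `m`. -/
theorem Matrix.rank_le_of_sq_dist_mul_eq_smul {V : Type*} [Fintype V] {m : ℕ}
    (f : V → EuclideanSpace ℝ (Fin m)) {E : Matrix V V ℝ} (hJ : ∀ v, ∑ u, E u v = 0) {c : ℝ}
    (hc : c ≠ 0)
    (hD : (Matrix.of fun u v => ‖f u - f v‖ ^ 2) * E = c • E) : E.rank ≤ m := by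
  let F : Matrix V (Fin m) ℝ := Matrix.of fun v i => f v i
  have hF : ∀ u v, (F * Fᵀ) u v = inner ℝ (f u) (f v) := by
    intro u v
    simp [F, Matrix.mul_apply, PiLp.inner_apply, mul_comm]
  -- Expand `‖f u - f v‖²`: the two rank-one terms vanish between `Eᵀ` and `E`, whose columns sum to
  -- zero.
  have key : Eᵀ * ((Matrix.of fun u v => ‖f u - f v‖ ^ 2) * E) = (-2 : ℝ) • (Eᵀ * (F * Fᵀ * E)) := by
    have h1 : (Matrix.of fun u v => ‖f u - f v‖ ^ 2) =
        Matrix.vecMulVec (fun u => ‖f u‖ ^ 2) 1 + Matrix.vecMulVec 1 (fun u => ‖f u‖ ^ 2)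
          - (2 : ℝ) • (F * Fᵀ) := by
      ext u v
      simp only [Matrix.of_apply, Matrix.sub_apply, Matrix.add_apply, Matrix.smul_apply, hF,
        Matrix.vecMulVec_apply, Pi.one_apply, norm_sub_sq_real, smul_eq_mul]
      ring
    have h2 : (1 : V → ℝ) ᵥ* E = 0 := by
      ext v
      simp [Matrix.vecMul, dotProduct, hJ]
    have h3 : Eᵀ *ᵥ (1 : V → ℝ) = 0 := by
      rw [Matrix.mulVec_transpose, h2]
    rw [h1, Matrix.sub_mul, Matrix.add_mul, Matrix.vecMulVec_mul, Matrix.vecMulVec_mul, h2,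
      Matrix.mul_sub, Matrix.mul_add, Matrix.mul_vecMulVec, Matrix.mul_vecMulVec, h3]
    simp
  rw [hD, Matrix.mul_smul] at key
  have h4 : Eᵀ * E = Eᵀ * F * ((-2 / c) • (Fᵀ * E)) := by
    rw [Matrix.mul_smul, ← inv_smul_smul₀ hc (Eᵀ * E), key, smul_smul]
    simp only [Matrix.mul_assoc]
    congr 1
    ring
  calc E.rank = (Eᵀ * E).rank := (Matrix.rank_transpose_mul_self E).symm
    _ ≤ (Eᵀ * F).rank := h4 ▸ Matrix.rank_mul_le_left _ _
    _ ≤ m := (Matrix.rank_le_card_width _).trans_eq (Fintype.card_fin m)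

/-- In a strongly regular graph that is not complete multipartite, `μ < k`. -/
theorem SimpleGraph.IsSRGWith.mu_lt {V : Type*} [Fintype V] [DecidableEq V] {G : SimpleGraph V}
    [DecidableRel G.Adj] {n k l μ : ℕ} (hG : G.IsSRGWith n k l μ)
    (hmulti : ¬ G.IsCompleteMultipartite) : μ < k := by
  obtain ⟨u, v, w, huv, hvw, huw⟩ : ∃ u v w, ¬ G.Adj u v ∧ ¬ G.Adj v w ∧ G.Adj u w := by
    by_contra! h
    exact hmulti ⟨fun u v w h1 h2 => h u v w h1 h2⟩
  have hne : v ≠ w := by rintro rfl; exact huv huw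
  rw [← hG.of_not_adj hne hvw, ← hG.regular w, ← G.card_neighborSet_eq_degree]
  have hne' : v ≠ u := by rintro rfl; exact hvw huw
  refine Set.card_lt_card ⟨Set.inter_subset_right, fun h => huv (h huw.symm).1.symm⟩

/-- In a strongly regular graph whose complement is not complete multipartite, `l + 1 < k`. -/
theorem SimpleGraph.IsSRGWith.lambda_add_one_lt {V : Type*} [Fintype V] [DecidableEq V] {G : SimpleGraph V}
    [DecidableRel G.Adj] {n k l μ : ℕ} (hG : G.IsSRGWith n k l μ)
    (hcompl : ¬ Gᶜ.IsCompleteMultipartite) : l + 1 < k := by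
  obtain ⟨u, v, w, huv, hvw, huw⟩ : ∃ u v w, ¬ Gᶜ.Adj u v ∧ ¬ Gᶜ.Adj v w ∧ Gᶜ.Adj u w := by
    by_contra! h
    exact hcompl ⟨fun u v w h1 h2 => h u v w h1 h2⟩
  rw [SimpleGraph.compl_adj] at huv hvw huw
  have h1 : u ≠ v := by rintro rfl; exact hvw huw
  have h2 : v ≠ w := by rintro rfl; exact huv huw
  have h3 : G.Adj u v := by tauto
  have h4 : G.Adj v w := by tauto
  rw [← hG.of_adj u v h3, ← hG.regular v, ← G.card_neighborFinset_eq_degree, ← Set.toFinset_card]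
  -- Neither `u` nor `w` is a common neighbour of `u` and `v`, so `v` has at least `l + 2`
  -- neighbours.
  have hsub : insert w (insert u (G.commonNeighbors u v).toFinset) ⊆ G.neighborFinset v := by
    intro x
    simp only [Finset.mem_insert, Set.mem_toFinset, SimpleGraph.mem_commonNeighbors,
      SimpleGraph.mem_neighborFinset]
    rintro (rfl | rfl | h)
    exacts [h4, h3.symm, h.2]
  have := Finset.card_le_card hsub
  rw [Finset.card_insert_of_notMem, Finset.card_insert_of_notMem] at this
  · omega
  · simp [SimpleGraph.mem_commonNeighbors]
  · simp only [Finset.mem_insert, Set.mem_toFinset, SimpleGraph.mem_commonNeighbors]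
    tauto

theorem SimpleGraph.adjMatrix_compl_eq {V : Type*} [DecidableEq V] (G : SimpleGraph V) [DecidableRel G.Adj] :
    Gᶜ.adjMatrix ℝ = (Matrix.of fun _ _ => (1 : ℝ)) - 1 - G.adjMatrix ℝ := by
  ext i j
  rcases eq_or_ne i j with rfl | h
  · simp
  · by_cases h2 : G.Adj i j <;> simp [h, h2]

/-- If `a` and `b` are the two eigenvalues of a strongly regular graph other than its degree `k`,
this is the orthogonal projection onto the eigenspace of `a` inside the sum-zero vectors. -/
noncomputable def SimpleGraph.eigenProj {V : Type*} [DecidableEq V] (G : SimpleGraph V)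
    [DecidableRel G.Adj] (n k : ℕ) (a b : ℝ) : Matrix V V ℝ :=
  (a - b)⁻¹ • (G.adjMatrix ℝ - b • (1 : Matrix V V ℝ) - ((k - b) / n) • Matrix.of fun _ _ => (1 : ℝ))

namespace SimpleGraph.IsSRGWith

open Matrix

variable {V : Type*} [Fintype V] {G : SimpleGraph V} [DecidableRel G.Adj]
  {n k l μ : ℕ} {a b : ℝ}

theorem adjMatrix_mul_ones (hG : G.IsSRGWith n k l μ) :
    G.adjMatrix ℝ * (of fun _ _ => (1 : ℝ)) = (k : ℝ) • of fun _ _ => (1 : ℝ) := by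
  ext i j
  simp [hG.regular i]

theorem ones_mul_adjMatrix (hG : G.IsSRGWith n k l μ) :
    (of fun _ _ => (1 : ℝ)) * G.adjMatrix ℝ = (k : ℝ) • of fun _ _ => (1 : ℝ) := by
  ext i j
  simp [hG.regular j]

theorem ones_mul_ones (hG : G.IsSRGWith n k l μ) :
    (of fun _ _ => (1 : ℝ)) * (of fun _ _ => (1 : ℝ)) =
      (n : ℝ) • (of fun _ _ => (1 : ℝ) : Matrix V V ℝ) := by
  ext i j
  simp [mul_apply, hG.card]

variable [DecidableEq V]

theorem adjMatrix_mul_self (hG : G.IsSRGWith n k l μ) :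
    G.adjMatrix ℝ * G.adjMatrix ℝ = ((k : ℝ) - μ) • (1 : Matrix V V ℝ) +
      ((l : ℝ) - μ) • G.adjMatrix ℝ + (μ : ℝ) • of fun _ _ => (1 : ℝ) := by
  rw [← pow_two, hG.matrix_eq, adjMatrix_compl_eq]
  module

/-- The standard relation between the parameters of a strongly regular graph. -/
theorem param_identity [Nonempty V] (hG : G.IsSRGWith n k l μ) :
    (k : ℝ) * k = (k - μ) + (l - μ) * k + μ * n := by
  have h := congrArg (· * (of fun _ _ => (1 : ℝ) : Matrix V V ℝ)) hG.adjMatrix_mul_self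
  simp only [Matrix.mul_assoc, Matrix.add_mul, smul_mul, hG.adjMatrix_mul_ones, Matrix.mul_smul,
    hG.ones_mul_ones, Matrix.one_mul] at h
  obtain ⟨v⟩ := ‹Nonempty V›
  simpa [hG.regular v] using congrFun₂ h v v

theorem ones_mul_eigenProj (hG : G.IsSRGWith n k l μ) (hn : (n : ℝ) ≠ 0) :
    (of fun _ _ => (1 : ℝ)) * G.eigenProj n k a b = 0 := by
  simp only [eigenProj, Matrix.mul_smul, Matrix.mul_sub, hG.ones_mul_adjMatrix, hG.ones_mul_ones,
    Matrix.mul_one, smul_smul, div_mul_cancel₀ _ hn]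
  module

theorem adjMatrix_mul_eigenProj [Nonempty V] (hG : G.IsSRGWith n k l μ) (hn : (n : ℝ) ≠ 0)
    (hadd : a + b = l - μ) (hmul : a * b = μ - k) :
    G.adjMatrix ℝ * G.eigenProj n k a b = a • G.eigenProj n k a b := by
  have hp := hG.param_identity
  simp only [eigenProj, Matrix.mul_smul, Matrix.mul_sub, hG.adjMatrix_mul_self, hG.adjMatrix_mul_ones,
    Matrix.mul_one]
  rw [smul_comm a]
  congr 1
  have h1 : (k : ℝ) - μ = - (a * b) := by linarith
  -- The coefficient of `J`; this is the parameter identity in the form `(k - a)(k - b) = μ n`.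
  have h2 : (μ : ℝ) = (k - b) / n * k - a * ((k - b) / n) := by
    field_simp
    linear_combination -hp + k * hadd - hmul
  rw [h1, ← hadd]
  rw [h2]
  module

/-- Only the left factor is expanded: on the right one, `A` acts as `a` and `J` as zero, leaving `(a
- b)⁻¹ (a - b)`. -/
theorem isIdempotentElem_eigenProj [Nonempty V] (hG : G.IsSRGWith n k l μ) (hn : (n : ℝ) ≠ 0)
    (hadd : a + b = l - μ) (hmul : a * b = μ - k) (hab : a ≠ b) :
    IsIdempotentElem (G.eigenProj n k a b) := by
  have h : (a - b)⁻¹ * (a - b) = 1 := inv_mul_cancel₀ (sub_ne_zero.2 hab)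
  unfold IsIdempotentElem
  conv_lhs => enter [1]; rw [eigenProj]
  rw [smul_mul, Matrix.sub_mul, Matrix.sub_mul, smul_mul, smul_mul, hG.ones_mul_eigenProj hn,
    hG.adjMatrix_mul_eigenProj hn hadd hmul, Matrix.one_mul, smul_zero, sub_zero, ← sub_smul,
    smul_smul, h, one_smul]

theorem rank_eigenProj [Nonempty V] (hG : G.IsSRGWith n k l μ) (hn : (n : ℝ) ≠ 0)
    (hadd : a + b = l - μ) (hmul : a * b = μ - k) (hab : a ≠ b) :
    ((G.eigenProj n k a b).rank : ℝ) = -(b * (n - 1) + k) / (a - b) := by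
  rw [rank_eq_trace_of_isIdempotentElem (hG.isIdempotentElem_eigenProj hn hadd hmul hab)]
  have hJ : trace (of fun _ _ => (1 : ℝ) : Matrix V V ℝ) = n := by simp [trace, hG.card]
  rw [eigenProj, trace_smul, trace_sub, trace_sub, trace_smul, trace_smul, hJ, trace_one, hG.card,
    trace_adjMatrix, smul_eq_mul, smul_eq_mul, smul_eq_mul, div_mul_cancel₀ _ hn, div_eq_inv_mul]
  ring

/-- The columns of the projection onto an eigenspace represent the graph. -/
theorem isRepresentable_rank_eigenProj [Nonempty V] (hG : G.IsSRGWith n k l μ) (hn : (n : ℝ) ≠ 0)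
    (hadd : a + b = l - μ) (hmul : a * b = μ - k) (hab : a ≠ b)
    (h0 : 0 < -b / (a - b)) (h1 : 0 < (-1 - b) / (a - b)) :
    G.IsRepresentable (G.eigenProj n k a b).rank := by
  have hsymm : (G.eigenProj n k a b).IsSymm := by
    ext i j
    simp [eigenProj, G.adj_comm, Matrix.one_apply, eq_comm]
  obtain ⟨f, hf⟩ := exists_inner_eq_of_isIdempotentElem
    (hG.isIdempotentElem_eigenProj hn hadd hmul hab) hsymm
  have hd (u v : V) : ‖f u - f v‖ = √(G.eigenProj n k a b u u - 2 * G.eigenProj n k a b u v +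
      G.eigenProj n k a b v v) := by
    rw [← hf, ← hf, ← hf, real_inner_self_eq_norm_sq, real_inner_self_eq_norm_sq,
      ← norm_sub_sq_real, Real.sqrt_sq (norm_nonneg _)]
  refine ⟨f, √(2 * ((-1 - b) / (a - b))), √(2 * (-b / (a - b))), by positivity, by positivity,
    fun h => ?_, fun u v huv => ⟨fun h => ?_, fun h => ?_⟩⟩
  · rw [Real.sqrt_inj (by positivity) (by positivity)] at h
    have := (div_left_inj' (sub_ne_zero.2 hab)).1 (mul_left_cancel₀ two_ne_zero h)
    linarith
  · rw [hd]
    congr 1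
    simp [eigenProj, h, huv]
    ring
  · rw [hd]
    congr 1
    simp [eigenProj, h, huv]
    ring

/-- If `a` does not annihilate the squared distances of a representation in `ℝ^m`, then the
eigenspace of `a` has dimension at most `m`. -/
theorem rank_eigenProj_le [Nonempty V] (hG : G.IsSRGWith n k l μ) (hn : (n : ℝ) ≠ 0)
    (hadd : a + b = l - μ) (hmul : a * b = μ - k) {m : ℕ} (f : V → EuclideanSpace ℝ (Fin m))
    {α β : ℝ} (hf : ∀ u v : V, u ≠ v →
      (G.Adj u v → ‖f u - f v‖ = α) ∧ (¬ G.Adj u v → ‖f u - f v‖ = β))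
    (hc : (α ^ 2 - β ^ 2) * a - β ^ 2 ≠ 0) : (G.eigenProj n k a b).rank ≤ m := by
  have hJ := hG.ones_mul_eigenProj (a := a) (b := b) hn
  refine rank_le_of_sq_dist_mul_eq_smul f (fun v => ?_) hc ?_
  · simpa [mul_apply] using congrFun₂ hJ v v
  · have hD : (of fun u v => ‖f u - f v‖ ^ 2) = (α ^ 2 - β ^ 2) • G.adjMatrix ℝ
        - β ^ 2 • (1 : Matrix V V ℝ) + β ^ 2 • of fun _ _ => (1 : ℝ) := by
      ext u v
      rcases eq_or_ne u v with rfl | huv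
      · simp
      · by_cases h : G.Adj u v
        · simp [h, huv, (hf u v huv).1 h]
        · simp [h, huv, (hf u v huv).2 h]
    rw [hD, Matrix.add_mul, Matrix.sub_mul, smul_mul, smul_mul, smul_mul, hJ,
      hG.adjMatrix_mul_eigenProj hn hadd hmul, Matrix.one_mul]
    module

end SimpleGraph.IsSRGWith

theorem mainTheorem8 {V : Type*} [Fintype V] [DecidableEq V] (G : SimpleGraph V)
    [DecidableRel G.Adj] (n k l μ : ℕ) (hG : G.IsSRGWith n k l μ)
    (hmulti : ¬ G.IsCompleteMultipartite) (hcompl : ¬ Gᶜ.IsCompleteMultipartite) :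
    IsLeast {m : ℕ | G.IsRepresentable m} G.rep ∧
    0 < ((μ : ℝ) - l) ^ 2 + 4 * ((k : ℝ) - μ) ∧
    (G.rep : ℝ) = 1 / 2 * ((n : ℝ) - 1 -
      |((n : ℝ) - 1) * ((μ : ℝ) - l) - 2 * k| /
        Real.sqrt (((μ : ℝ) - l) ^ 2 + 4 * ((k : ℝ) - μ))) := by
  have hV : Nonempty V := by
    by_contra h
    rw [not_nonempty_iff] at h
    exact hmulti ⟨fun u => isEmptyElim u⟩
  have hn : (n : ℝ) ≠ 0 := by
    rw [← hG.card]
    exact_mod_cast Fintype.card_ne_zero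
  have hμ : (μ : ℝ) < k := by exact_mod_cast hG.mu_lt hmulti
  have hl : (l : ℝ) + 1 < k := by exact_mod_cast hG.lambda_add_one_lt hcompl
  have hpos : 0 < ((μ : ℝ) - l) ^ 2 + 4 * ((k : ℝ) - μ) := by nlinarith [sq_nonneg ((μ : ℝ) - l)]
  set s := Real.sqrt (((μ : ℝ) - l) ^ 2 + 4 * ((k : ℝ) - μ)) with hs
  have hs0 : 0 < s := Real.sqrt_pos.2 hpos
  have hss : s ^ 2 = ((μ : ℝ) - l) ^ 2 + 4 * ((k : ℝ) - μ) := Real.sq_sqrt hpos.le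
  obtain ⟨a, ha⟩ : ∃ a, a = ((l : ℝ) - μ + s) / 2 := ⟨_, rfl⟩
  obtain ⟨b, hb⟩ : ∃ b, b = ((l : ℝ) - μ - s) / 2 := ⟨_, rfl⟩
  have hadd : a + b = l - μ := by rw [ha, hb]; ring
  have hsub : a - b = s := by rw [ha, hb]; ring
  have hmul : a * b = μ - k := by rw [ha, hb]; linear_combination -hss / 4
  have hadd' : b + a = l - μ := by rw [add_comm, hadd]
  have hmul' : b * a = μ - k := by rw [mul_comm, hmul]
  have hab : b < a := by linarith
  -- `a * b = μ - k < 0`.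
  have ha0 : 0 < a := by
    by_contra! h
    nlinarith [mul_nonneg_of_nonpos_of_nonpos h (hab.le.trans h)]
  -- `(a + 1) * (b + 1) = l + 1 - k < 0`.
  have hb1 : b < -1 := by
    by_contra! h
    nlinarith [mul_nonneg (by linarith : 0 ≤ a + 1) (by linarith : 0 ≤ b + 1)]
  have hra := hG.rank_eigenProj hn hadd hmul hab.ne'
  have hrb := hG.rank_eigenProj hn hadd' hmul' hab.ne
  have hRa := hG.isRepresentable_rank_eigenProj hn hadd hmul hab.ne'
    (div_pos (by linarith) (by linarith)) (div_pos (by linarith) (by linarith))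
  have hRb := hG.isRepresentable_rank_eigenProj hn hadd' hmul' hab.ne
    (div_pos_of_neg_of_neg (by linarith) (by linarith))
    (div_pos_of_neg_of_neg (by linarith) (by linarith))
  have hleast : IsLeast {m : ℕ | G.IsRepresentable m}
      (min (G.eigenProj n k a b).rank (G.eigenProj n k b a).rank) := by
    constructor
    · rcases min_choice (G.eigenProj n k a b).rank (G.eigenProj n k b a).rank with h | h <;>
        rw [h] <;> assumption
    · rintro m ⟨f, α, β, hα, hβ, hne, hf⟩
      by_cases hc : (α ^ 2 - β ^ 2) * a - β ^ 2 = 0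
      · refine (min_le_right _ _).trans (hG.rank_eigenProj_le hn hadd' hmul' f hf fun hc' => ?_)
        have h1 : (α ^ 2 - β ^ 2) * (a - b) = 0 := by linear_combination hc - hc'
        rcases mul_eq_zero.1 h1 with h2 | h2
        · exact hne ((sq_eq_sq₀ hα.le hβ.le).1 (sub_eq_zero.1 h2))
        · linarith
      · exact (min_le_left _ _).trans (hG.rank_eigenProj_le hn hadd hmul f hf hc)
  have hrep : G.rep = min (G.eigenProj n k a b).rank (G.eigenProj n k b a).rank :=
    hleast.csInf_eq
  refine ⟨hrep ▸ hleast, hpos, ?_⟩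
  -- The multiplicities are `(n - 1 ± x / s) / 2`; their minimum produces `|x|`.
  obtain ⟨x, hx⟩ : ∃ x, x = ((n : ℝ) - 1) * ((μ : ℝ) - l) - 2 * k := ⟨_, rfl⟩
  have hra' : ((G.eigenProj n k a b).rank : ℝ) = 1 / 2 * (n - 1 - -x / s) := by
    rw [hra, hsub, hb, hx]
    field_simp
    ring
  have hrb' : ((G.eigenProj n k b a).rank : ℝ) = 1 / 2 * (n - 1 - x / s) := by
    rw [hrb, ← neg_sub a b, hsub, ha, hx]
    field_simp
    ring
  rw [hrep, Nat.cast_min, hra', hrb', ← hx]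
  rcases le_total 0 x with h | h
  · rw [abs_of_nonneg h, min_eq_right]
    gcongr
    linarith
  · rw [abs_of_nonpos h, min_eq_left]
    gcongr
    linarith
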